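/- **Notation.** For a lattice $\Lambda$ in a Euclidean space let $\Lambda^*=\{y\in\mathrm{span}(\Lambda):\langle x,y\rangle\in\mathbb Z\ \forall x\in\Lambda\}$, $\rho(x)=e^{-\pi\langle x,x\rangle}$, and for $\epsilon\in(0,1)$ let $\eta_\epsilon(\Lambda)=\inf\{s>0:\rho(s\Lambda^*)\le 1+\epsilon\}$, where $\rho(S)=\sum_{x\in S}\rho(x)$. For a positive definite $\Sigma\in\mathbb R^{k\times k}$ let $D_{\mathbb Z^k,\sqrt\Sigma}$ be the probability distribution on $\mathbb Z^k$ with $D_{\mathbb Z^k,\sqrt\Sigma}(x)$ proportional to $e^{-\pi x^t\Sigma^{-1}x}$, and $D_{\mathbb Z^k,s}=D_{\mathbb Z^k,\sqrt{s^2I_k}}$. Let $s_1(T)=\max_{x\ne0}\|Tx\|/\|x\|$ be the largest singular value (with $s_1(T)=0$ if $T$ has no columns). The statistical distance of two distributions on a countable set is $\Delta(P,Q)=\frac12\sum_a|P(a)-Q(a)|$. A function $f:\mathbb N\to\mathbb R$ of the security parameter $\kappa$ is negligible if $\kappa^df(\kappa)\to0$ for every $d\in\mathbb N$. **Statement.**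 Let $n=n(\kappa)\in\mathbb N$ be polynomially bounded in the security parameter $\kappa$, and let $\epsilon=\epsilon(\kappa)\in(0,1)$ be negligible. Then there is a negligible function $\delta$ (depending only on $n(\cdot)$ and $\epsilon(\cdot)$) such that for every $\kappa$, every $m\in\mathbb N$, every integer matrix $T\in\mathbb Z^{m\times n}$ and all reals $r,s>0$ with $$r\ge\eta_\epsilon(\mathbb Z^n),\qquad s^2\ge\bigl(r^2+\eta_\epsilon(\mathbb Z^n)^2\bigr)\bigl(s_1(T)^2+1\bigr),$$ the following holds for $\Sigma_p=s^2I_m-r^2TT^t$ and $L=[I_m\mid T]$: 1. $\Sigma_p$ is positive definite; 2. $L\cdot D_{\mathbb Z^{m+n},\sqrt{\Sigma_p\oplus r^2I_n}}$ (the distribution of $Lx$ for $x\leftarrow D_{\mathbb Z^{m+n},\sqrt{\Sigma_p\oplus r^2I_n}}$) is the distribution of $p+Tx'$ for independent $p\leftarrow D_{\mathbb Z^m,\sqrt{\Sigma_p}}$ and $x'\leftarrow D_{\mathbb Z^n,r}$; 3. $L\cdot D_{\mathbb Z^{m+n},\sqrt{\Sigma_p\oplus r^2I_n}}$ is statistically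 close to $D_{\mathbb Z^m,s}$: $$\Delta\bigl(L\cdot D_{\mathbb Z^{m+n},\sqrt{\Sigma_p\oplus r^2I_n}},\;D_{\mathbb Z^m,s}\bigr)\le\delta(\kappa).$$ -/

import Mathlib

open Matrix

noncomputable section

namespace LatticeGaussian

/-! ### Lattices, dual lattices and the smoothing parameter -/

section Smoothing

variable {E : Type*} [NormedAddCommGroup E] [InnerProductSpace ℝ E]

/-- The dual `Λ* = {y ∈ span Λ | ⟪x, y⟫ ∈ ℤ for all x ∈ Λ}` of a lattice `Λ`. -/
def dualLattice (Λ : Submodule ℤ E) : Set E :=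
  {y | y ∈ Submodule.span ℝ (Λ : Set E) ∧ ∀ x ∈ Λ, ∃ k : ℤ, inner ℝ x y = (k : ℝ)}

/-- The Gaussian function `ρ(x) = exp(-π ⟪x, x⟫)`. -/
def rho (x : E) : ℝ := Real.exp (-Real.pi * inner ℝ x x)

/-- The total mass `ρ(s · S) = ∑_{y ∈ S} ρ(s y)`, a sum of nonnegative terms in `[0, ∞]`. -/
def rhoMass (s : ℝ) (S : Set E) : ENNReal := ∑' y : S, ENNReal.ofReal (rho (s • (y : E)))

/-- The smoothing parameter `η_ε(Λ)`: the least `s > 0` with `ρ(s · Λ*) ≤ 1 + ε`. -/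
def smoothingParameter (Λ : Submodule ℤ E) (ε : ℝ) : ℝ :=
  sInf {s : ℝ | 0 < s ∧ rhoMass s (dualLattice Λ) ≤ ENNReal.ofReal (1 + ε)}

end Smoothing

/-- The integer lattice `ℤⁿ` in Euclidean space. -/
def integerLattice (n : ℕ) : Submodule ℤ (EuclideanSpace ℝ (Fin n)) :=
  Submodule.span ℤ (Set.range (EuclideanSpace.basisFun (Fin n) ℝ))

/-- The largest singular value `s₁(A) = max_{x ≠ 0} ‖A x‖ / ‖x‖` (Euclidean operator norm). -/
def largestSingularValue {m n : ℕ} (A : Matrix (Fin m) (Fin n) ℝ) : ℝ :=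
  ‖(Matrix.toEuclideanLin A).toContinuousLinearMap‖

/-! ### Discrete Gaussians on `ℤ^ι` -/

section Gaussian

variable {ι : Type*} [Fintype ι]

lemma exists_lower_bound {A : Matrix ι ι ℝ} (hA : A.PosDef) :
    ∃ c : ℝ, 0 < c ∧ ∀ x : ι → ℝ, c * ∑ i, x i ^ 2 ≤ x ⬝ᵥ (A *ᵥ x) := by
  have hcont : Continuous fun x : EuclideanSpace ℝ ι => x.ofLp ⬝ᵥ (A *ᵥ x.ofLp) := by
    unfold dotProduct Matrix.mulVec dotProduct
    fun_prop
  obtain h0 | hne := (Metric.sphere (0 : EuclideanSpace ℝ ι) 1).eq_empty_or_nonempty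
  · refine ⟨1, one_pos, fun x => ?_⟩
    have hx : x = 0 := by
      by_contra hx
      have hx' : WithLp.toLp 2 x ≠ (0 : EuclideanSpace ℝ ι) := by
        simpa using hx
      have : (‖WithLp.toLp 2 x‖⁻¹ • WithLp.toLp 2 x : EuclideanSpace ℝ ι) ∈
          Metric.sphere (0 : EuclideanSpace ℝ ι) 1 := by
        simp [norm_smul, norm_ne_zero_iff.mpr hx']
      simp [h0] at this
    simp [hx]
  · obtain ⟨v, hv, hmin⟩ := (isCompact_sphere (0 : EuclideanSpace ℝ ι) 1).exists_isMinOn hne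
      hcont.continuousOn
    have hv0 : v.ofLp ≠ 0 := by
      intro h
      have : v = 0 := by ext i; simp [h]
      simp [this] at hv
    refine ⟨v.ofLp ⬝ᵥ (A *ᵥ v.ofLp), by simpa using hA.dotProduct_mulVec_pos hv0, fun x => ?_⟩
    by_cases hx : x = 0
    · simp [hx]
    set y : EuclideanSpace ℝ ι := WithLp.toLp 2 x with hy
    have hy0 : y ≠ 0 := by simpa [hy] using hx
    have hn : ‖y‖ ≠ 0 := norm_ne_zero_iff.mpr hy0
    have hmem : ‖y‖⁻¹ • y ∈ Metric.sphere (0 : EuclideanSpace ℝ ι) 1 := by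
      simp [norm_smul, hn]
    have h := hmin hmem
    simp only [Set.mem_ofPred_eq, WithLp.ofLp_smul, Matrix.mulVec_smul, dotProduct_smul,
      smul_dotProduct, smul_eq_mul] at h
    have hsq : ∑ i, x i ^ 2 = ‖y‖ ^ 2 := by
      rw [EuclideanSpace.norm_sq_eq]; simp [hy]
    rw [hsq]
    calc _ ≤ (‖y‖⁻¹ * (‖y‖⁻¹ * (y.ofLp ⬝ᵥ (A *ᵥ y.ofLp)))) * ‖y‖ ^ 2 := by gcongr
      _ = x ⬝ᵥ (A *ᵥ x) := by field_simp; simp [hy]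

lemma summable_exp_neg_mul_sq {a : ℝ} (ha : 0 < a) :
    Summable fun k : ℤ => Real.exp (-a * (k : ℝ) ^ 2) := by
  have hN : Summable fun k : ℕ => Real.exp (-a * (k : ℝ) ^ 2) := by
    refine Summable.of_nonneg_of_le (fun _ => (Real.exp_pos _).le) (fun k => ?_)
      (Real.summable_exp_nat_mul_iff.mpr (neg_lt_zero.mpr ha))
    apply Real.exp_le_exp.mpr
    have h1 : (k : ℝ) ≤ (k : ℝ) ^ 2 := by exact_mod_cast Nat.le_self_pow two_ne_zero k
    nlinarith
  exact Summable.of_nat_of_neg (by simpa using hN) (by simpa using hN)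

variable [DecidableEq ι]

/-- `ρ_{√Σ}(x) = exp(-π xᵗ Σ⁻¹ x)` at an integer vector `x`. -/
def gaussianWeight (S : Matrix ι ι ℝ) (x : ι → ℤ) : ℝ :=
  Real.exp (-Real.pi * ((fun i => (x i : ℝ)) ⬝ᵥ (S⁻¹ *ᵥ fun i => (x i : ℝ))))

/-- The Gaussian mass of `ℤ^ι` is finite, so the discrete Gaussian is well defined. -/
lemma summable_gaussianWeight {S : Matrix ι ι ℝ} (hS : S.PosDef) :
    Summable (gaussianWeight S) := by
  obtain ⟨c, hc, hle⟩ := exists_lower_bound hS.inv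
  have hs := summable_exp_neg_mul_sq (mul_pos Real.pi_pos hc)
  refine summable_of_sum_le (c := ∏ _i : ι, ∑' k : ℤ, Real.exp (-(Real.pi * c) * (k : ℝ) ^ 2))
    (fun _ => (Real.exp_pos _).le) (fun u => ?_)
  calc ∑ x ∈ u, gaussianWeight S x
      ≤ ∑ x ∈ u, ∏ i, Real.exp (-(Real.pi * c) * (x i : ℝ) ^ 2) := by
        refine Finset.sum_le_sum fun x _ => ?_
        rw [← Real.exp_sum, ← Finset.mul_sum]
        apply Real.exp_le_exp.mpr
        have := mul_le_mul_of_nonneg_left (hle fun i => (x i : ℝ)) Real.pi_pos.le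
        linarith
    _ ≤ ∑ x ∈ Fintype.piFinset (fun i => u.image (fun x : ι → ℤ => x i)),
          ∏ i, Real.exp (-(Real.pi * c) * (x i : ℝ) ^ 2) := by
        refine Finset.sum_le_sum_of_subset_of_nonneg (fun x hx => ?_)
          (fun _ _ _ => Finset.prod_nonneg fun _ _ => (Real.exp_pos _).le)
        exact Fintype.mem_piFinset.mpr fun i => Finset.mem_image_of_mem _ hx
    _ = ∏ i, ∑ k ∈ u.image (fun x : ι → ℤ => x i), Real.exp (-(Real.pi * c) * (k : ℝ) ^ 2) :=
        (Finset.prod_univ_sum (fun i => u.image (fun x : ι → ℤ => x i))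
          (fun _ k => Real.exp (-(Real.pi * c) * (k : ℝ) ^ 2))).symm
    _ ≤ _ := Finset.prod_le_prod (fun _ _ => Finset.sum_nonneg fun _ _ => (Real.exp_pos _).le)
        fun i _ => hs.sum_le_tsum _ fun _ _ => (Real.exp_pos _).le

lemma tsum_gaussianWeight_ne_zero (S : Matrix ι ι ℝ) :
    ∑' x, ENNReal.ofReal (gaussianWeight S x) ≠ 0 := by
  intro h
  have := ENNReal.tsum_eq_zero.mp h 0
  rw [ENNReal.ofReal_eq_zero] at this
  exact absurd (Real.exp_pos _) (not_lt.mpr this)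

lemma tsum_gaussianWeight_ne_top {S : Matrix ι ι ℝ} (hS : S.PosDef) :
    ∑' x, ENNReal.ofReal (gaussianWeight S x) ≠ ⊤ :=
  (summable_gaussianWeight hS).tsum_ofReal_ne_top

open Classical in
/-- The discrete Gaussian `D_{ℤ^ι, √Σ}`, giving `x` the probability `ρ_{√Σ}(x) / ρ_{√Σ}(ℤ^ι)`.
It is meaningful for positive definite `Σ` only; any other matrix gets a point mass. -/
def discreteGaussian (S : Matrix ι ι ℝ) : PMF (ι → ℤ) :=
  if hS : S.PosDef then
    PMF.normalize (fun x => ENNReal.ofReal (gaussianWeight S x))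
      (tsum_gaussianWeight_ne_zero S) (tsum_gaussianWeight_ne_top hS)
  else PMF.pure 0

end Gaussian

/-- The statistical distance `½ ∑ₐ |P(a) - Q(a)|`. -/
def statisticalDistance {α : Type*} (P Q : PMF α) : ℝ :=
  (1 / 2) * ∑' a, |(P a).toReal - (Q a).toReal|

/-- A function of the security parameter is negligible if it decays faster than the inverse
of every polynomial. -/
def Negligible (f : ℕ → ℝ) : Prop :=
  Asymptotics.SuperpolynomialDecay Filter.atTop (fun κ : ℕ => (κ : ℝ)) f

/-- A function of the security parameter is polynomially bounded. -/
def PolynomiallyBounded (n : ℕ → ℕ) : Prop :=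
  ∃ d : ℕ, (fun κ : ℕ => (n κ : ℝ)) =O[Filter.atTop] fun κ : ℕ => (κ : ℝ) ^ d

/-! ### The trapdoor setting -/

section Trapdoor

variable {m n : ℕ}

/-- The real matrix with the entries of the integer matrix `T`. -/
def realMatrix (T : Matrix (Fin m) (Fin n) ℤ) : Matrix (Fin m) (Fin n) ℝ :=
  T.map fun k => (k : ℝ)

/-- The perturbation covariance `Σ_p = s² I_m - r² T Tᵗ`. -/
def perturbationCov (T : Matrix (Fin m) (Fin n) ℤ) (r s : ℝ) : Matrix (Fin m) (Fin m) ℝ :=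
  s ^ 2 • (1 : Matrix (Fin m) (Fin m) ℝ) - r ^ 2 • (realMatrix T * (realMatrix T)ᵀ)

/-- The block diagonal covariance `Σ_p ⊕ r² I_n`. -/
def jointCov (T : Matrix (Fin m) (Fin n) ℤ) (r s : ℝ) :
    Matrix (Fin m ⊕ Fin n) (Fin m ⊕ Fin n) ℝ :=
  Matrix.fromBlocks (perturbationCov T r s) 0 0 (r ^ 2 • (1 : Matrix (Fin n) (Fin n) ℝ))

/-- The matrix `L = [I_m | T]`. -/
def convolutionMatrix (T : Matrix (Fin m) (Fin n) ℤ) : Matrix (Fin m) (Fin m ⊕ Fin n) ℤ :=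
  Matrix.fromCols 1 T

end Trapdoor

end LatticeGaussian

end

open LatticeGaussian

/-! # Convolution of discrete Gaussians along an integer matrix -/

namespace LatticeGaussian

/-! ### One-dimensional shifted Gaussian sums -/

/-! The probability that `p + T x'` equals `y` is proportional to the sum over `x` of the Gaussian
weights of `y - T x` and `x`. Completing the square (`complete_square`) factors it as the weight of
`y` in `D_{ℤ^m, s}` times the mass of a Gaussian on `ℤⁿ` with precision matrix `A = r⁻² I + Tᵗ Σ_p⁻¹
T`, centred at `(r²/s²) Tᵗ y`. So closeness to `D_{ℤ^m, s}` amounts to this mass being almost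
independent of the centre.

Only the diagonal of `A` is needed for that. The centre is moved one coordinate at a time. Along
coordinate `i` the mass splits into one-dimensional Gaussian sums of parameter `A i i`, and by
Poisson summation a shift changes each of them by a factor of at most `1 + 12 x`, for any `x ≤ 1/8`
with `x ≥ exp(-π / A i i)`. All `n` moves together cost `(1 + 12 x) ^ n` (`shiftedMass_le`).

The lower bound on `s²` gives `A i i ≤ 2 / η²`, so `x = exp(-π η² / 2)` is allowed. The smoothing
condition, restricted to the origin and the `n` unit vectors, gives `n exp(-π η²) ≤ ε`, hence `n x ≤
√(n ε)`. The distance is therefore at most `24 √(n ε)`, which is negligible. -/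

lemma summable_exp_shifted_sq {a : ℝ} (ha : 0 < a) (u : ℝ) :
    Summable fun k : ℤ => Real.exp (-Real.pi * a * ((k : ℝ) + u) ^ 2) := by
  have h := (summable_exp_neg_mul_sq (a := Real.pi * a / 2) (by positivity)).mul_left
    (Real.exp (Real.pi * a * u ^ 2))
  refine Summable.of_nonneg_of_le (fun _ => (Real.exp_pos _).le) (fun k => ?_) h
  rw [← Real.exp_add]
  apply Real.exp_le_exp.mpr
  -- `(k + u)² - k²/2 + u² = (k + 2u)²/2`, hence the majorant with half the exponent.
  have h1 : 0 ≤ Real.pi * a * ((k : ℝ) + 2 * u) ^ 2 := by positivity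
  nlinarith

lemma hasSum_pow_natAbs {x : ℝ} (hx0 : 0 ≤ x) (hx1 : x < 1) :
    HasSum (fun k : ℤ => x ^ k.natAbs) ((1 + x) / (1 - x)) := by
  have hg := hasSum_geometric_of_lt_one hx0 hx1
  have h := HasSum.of_nat_of_neg_add_one (f := fun k : ℤ => x ^ k.natAbs)
    (m := (1 - x)⁻¹) (m' := x * (1 - x)⁻¹) (by simpa using hg) ?_
  · convert h using 1
    have : 1 - x ≠ 0 := by linarith
    field_simp
  · have h2 := hg.mul_left x
    refine h2.congr_fun fun k => ?_
    have : (-((k : ℤ) + 1)).natAbs = k + 1 := by omega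
    simp only [this]
    ring

/-- Poisson summation turns the shift `u` into phases on the terms `exp(-π k² / a)`. The term `k =
0` is `1`; since `k² ≥ |k|`, the others are dominated by a two-sided geometric series. -/
lemma abs_sqrt_mul_tsum_exp_shifted_sq_sub_one_le {a : ℝ} (ha : 0 < a) (u : ℝ) :
    |√a * ∑' k : ℤ, Real.exp (-Real.pi * a * ((k : ℝ) + u) ^ 2) - 1| ≤
      2 * Real.exp (-Real.pi / a) / (1 - Real.exp (-Real.pi / a)) := by
  set x := Real.exp (-Real.pi / a) with hx
  have hx0 : 0 < x := Real.exp_pos _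
  have hx1 : x < 1 := by
    rw [hx, Real.exp_lt_one_iff, neg_div, neg_lt_zero]
    exact div_pos Real.pi_pos ha
  set f : ℤ → ℂ := fun k => Complex.exp (-Real.pi * ((a⁻¹ : ℝ) : ℂ) * (k : ℂ) ^ 2 +
    2 * Real.pi * (-Complex.I * u) * k) with hf
  have hnorm : ∀ k : ℤ, ‖f k‖ ≤ x ^ k.natAbs := by
    intro k
    have hre : (-Real.pi * ((a⁻¹ : ℝ) : ℂ) * (k : ℂ) ^ 2 +
        2 * Real.pi * (-Complex.I * u) * k) =
        ((-Real.pi * a⁻¹ * (k : ℝ) ^ 2 : ℝ) : ℂ) +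
          ((-2 * Real.pi * u * k : ℝ) : ℂ) * Complex.I := by
      push_cast; ring
    rw [hf]
    simp only
    rw [Complex.norm_exp, hre, Complex.add_re, Complex.ofReal_re, Complex.re_ofReal_mul,
      Complex.I_re, mul_zero, add_zero, hx, ← Real.exp_nat_mul]
    apply Real.exp_le_exp.mpr
    have h1 : (k.natAbs : ℝ) ≤ (k : ℝ) ^ 2 := by
      have : (k.natAbs : ℤ) ≤ k ^ 2 := by
        rw [← Int.natAbs_sq]
        exact_mod_cast Nat.le_self_pow two_ne_zero _
      rw [Int.natCast_natAbs] at this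
      rw [Nat.cast_natAbs]
      exact_mod_cast this
    have h2 : 0 ≤ Real.pi * a⁻¹ := by positivity
    have h3 := mul_le_mul_of_nonneg_left h1 h2
    rw [neg_div, div_eq_mul_inv]
    linarith
  have hgeo := hasSum_pow_natAbs hx0.le hx1
  have hsum : Summable f := Summable.of_norm_bounded hgeo.summable hnorm
  have h0 : f 0 = 1 := by simp [hf]
  -- Here `f` is the Fourier side; the imaginary linear coefficient `-i u` becomes the real shift
  -- `u`.
  have hP := Complex.tsum_exp_neg_quadratic (a := ((a⁻¹ : ℝ) : ℂ))
    (by rw [Complex.ofReal_re]; positivity) (-Complex.I * u)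
  have hR : (1 / ((a⁻¹ : ℝ) : ℂ) ^ (1 / 2 : ℂ) * ∑' k : ℤ,
      Complex.exp (-Real.pi / ((a⁻¹ : ℝ) : ℂ) * (k + Complex.I * (-Complex.I * u)) ^ 2)) =
      ((√a * ∑' k : ℤ, Real.exp (-Real.pi * a * ((k : ℝ) + u) ^ 2) : ℝ) : ℂ) := by
    have hs : (((a⁻¹ : ℝ) : ℂ) ^ (1 / 2 : ℂ)) = (((√a)⁻¹ : ℝ) : ℂ) := by
      rw [← Real.sqrt_inv, Real.sqrt_eq_rpow, Complex.ofReal_cpow (by positivity)]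
      norm_num
    rw [hs]
    push_cast
    congr 1
    · simp
    · refine tsum_congr fun k => ?_
      congr 1
      have : Complex.I * (-Complex.I * (u : ℂ)) = u := by
        rw [← mul_assoc, mul_neg, Complex.I_mul_I]; simp
      rw [this]
      have : (a : ℂ) ≠ 0 := by exact_mod_cast ha.ne'
      field_simp
  rw [hR] at hP
  have hite := hasSum_ite_sub_hasSum hsum.hasSum 0
  have hgite := hasSum_ite_sub_hasSum hgeo 0
  have hle := tsum_of_norm_bounded (f := fun k : ℤ => if k = 0 then 0 else f k) hgite (fun k => by
    by_cases hk : k = 0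
    · simp [hk]
    · simpa [hk] using hnorm k)
  rw [hite.tsum_eq, h0] at hle
  have hP' : ∑' k, f k = _ := hP
  rw [hP', ← Complex.ofReal_one, ← Complex.ofReal_sub, Complex.norm_real, Real.norm_eq_abs] at hle
  refine hle.trans (le_of_eq ?_)
  have : 1 - x ≠ 0 := by linarith
  simp only [Int.natAbs_zero, pow_zero]
  field_simp
  ring

lemma tsum_exp_shifted_sq_le {a x : ℝ} (ha : 0 < a) (hx : Real.exp (-Real.pi / a) ≤ x)
    (hx8 : x ≤ 1 / 8) (u v : ℝ) :
    ∑' k : ℤ, Real.exp (-Real.pi * a * ((k : ℝ) + u) ^ 2) ≤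
      (1 + 12 * x) * ∑' k : ℤ, Real.exp (-Real.pi * a * ((k : ℝ) + v) ^ 2) := by
  have hu := abs_sqrt_mul_tsum_exp_shifted_sq_sub_one_le ha u
  have hv := abs_sqrt_mul_tsum_exp_shifted_sq_sub_one_le ha v
  set y := Real.exp (-Real.pi / a)
  have hy0 : 0 < y := Real.exp_pos _
  have hE : 2 * y / (1 - y) ≤ 3 * x := by
    rw [div_le_iff₀ (by linarith)]
    nlinarith
  have h1 := (abs_le.mp (hu.trans hE)).2
  have h2 := (abs_le.mp (hv.trans hE)).1
  refine le_of_mul_le_mul_left ?_ (Real.sqrt_pos.mpr ha)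
  -- `(1 + 3x) / (1 - 3x) ≤ 1 + 12x` holds for `0 ≤ x ≤ 1/6`.
  nlinarith

lemma tsum_ofReal_exp_shifted_sq_le {a x : ℝ} (ha : 0 < a) (hx : Real.exp (-Real.pi / a) ≤ x)
    (hx8 : x ≤ 1 / 8) (u v : ℝ) :
    ∑' k : ℤ, ENNReal.ofReal (Real.exp (-Real.pi * a * ((k : ℝ) + u) ^ 2)) ≤
      ENNReal.ofReal (1 + 12 * x) *
        ∑' k : ℤ, ENNReal.ofReal (Real.exp (-Real.pi * a * ((k : ℝ) + v) ^ 2)) := by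
  have hx0 : 0 < x := (Real.exp_pos _).trans_le hx
  rw [← ENNReal.ofReal_tsum_of_nonneg (fun _ => (Real.exp_pos _).le) (summable_exp_shifted_sq ha u),
    ← ENNReal.ofReal_tsum_of_nonneg (fun _ => (Real.exp_pos _).le) (summable_exp_shifted_sq ha v),
    ← ENNReal.ofReal_mul (by linarith)]
  exact ENNReal.ofReal_le_ofReal (tsum_exp_shifted_sq_le ha hx hx8 u v)

/-! ### Shifted Gaussian sums over `ℤ^ι` -/

section Shifted

variable {ι : Type*} [Fintype ι]

/-- The mass `∑ₓ exp(-π (x - c)ᵗ A (x - c))` of a Gaussian on `ℤ^ι` centred at `c`. -/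
noncomputable def shiftedMass (A : Matrix ι ι ℝ) (c : ι → ℝ) : ENNReal :=
  ∑' x : ι → ℤ, ENNReal.ofReal (Real.exp (-Real.pi *
    ((fun j => (x j : ℝ) - c j) ⬝ᵥ (A *ᵥ fun j => (x j : ℝ) - c j))))

lemma le_pow_card_mul_of_update_le [DecidableEq ι] {F : (ι → ℝ) → ENNReal} {R : ENNReal}
    (hF : ∀ c i t, F c ≤ R * F (Function.update c i t)) (c d : ι → ℝ) :
    F c ≤ R ^ Fintype.card ι * F d := by
  have key : ∀ s : Finset ι, F c ≤ R ^ s.card * F (s.piecewise d c) := by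
    intro s
    induction s using Finset.induction_on with
    | empty => simp
    | insert i s his ih =>
      rw [Finset.card_insert_of_notMem his, Finset.piecewise_insert, pow_succ, mul_assoc]
      exact ih.trans (mul_le_mul_right (hF _ i (d i)) _)
  simpa using key Finset.univ

variable [DecidableEq ι]

lemma dotProduct_mulVec_add_single {A : Matrix ι ι ℝ} (hA : Aᵀ = A) (w : ι → ℝ) (i : ι) (t : ℝ) :
    (w + Pi.single i t) ⬝ᵥ (A *ᵥ (w + Pi.single i t)) =
      w ⬝ᵥ (A *ᵥ w) + 2 * t * (A *ᵥ w) i + A i i * t ^ 2 := by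
  have h1 : w ⬝ᵥ (A *ᵥ Pi.single i t) = t * (A *ᵥ w) i := by
    rw [dotProduct_mulVec, ← mulVec_transpose, hA, dotProduct_single, mul_comm]
  have h2 : (A *ᵥ Pi.single i t) i = A i i * t := by
    simp [mulVec_single]
  rw [mulVec_add, add_dotProduct, dotProduct_add, dotProduct_add, h1, single_dotProduct,
    single_dotProduct, h2]
  ring

/-- With the other coordinates fixed, completing the square in coordinate `i` leaves a
one-dimensional shifted sum of parameter `A i i`, and the one-dimensional bound applies slice by
slice. -/
lemma shiftedMass_le_update {A : Matrix ι ι ℝ} (hA : Aᵀ = A) {i : ι} (hi : 0 < A i i) {x : ℝ}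
    (hx : Real.exp (-Real.pi / A i i) ≤ x) (hx8 : x ≤ 1 / 8) (c : ι → ℝ) (t : ℝ) :
    shiftedMass A c ≤ ENNReal.ofReal (1 + 12 * x) * shiftedMass A (Function.update c i t) := by
  -- Coordinate `i` is zeroed, so neither `w` nor the remainder `h` depends on the `i`-th coordinate
  -- of the centre.
  set w : ({j // j ≠ i} → ℤ) → ι → ℝ := fun z j => if h : j = i then 0 else (z ⟨j, h⟩ : ℝ) - c j
    with hw
  set h : ({j // j ≠ i} → ℤ) → ℝ := fun z =>
    w z ⬝ᵥ (A *ᵥ w z) - (A *ᵥ w z) i ^ 2 / A i i with hh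
  have key : ∀ t : ℝ, shiftedMass A (Function.update c i t) =
      ∑' z : {j // j ≠ i} → ℤ, ENNReal.ofReal (Real.exp (-Real.pi * h z)) *
        ∑' k : ℤ, ENNReal.ofReal (Real.exp (-Real.pi * A i i *
          ((k : ℝ) + ((A *ᵥ w z) i / A i i - t)) ^ 2)) := by
    intro t
    rw [shiftedMass, ← (Equiv.funSplitAt i ℤ).symm.tsum_eq, ENNReal.tsum_prod', ENNReal.tsum_comm]
    refine tsum_congr fun z => ?_
    rw [← ENNReal.tsum_mul_left]
    refine tsum_congr fun k => ?_
    rw [← ENNReal.ofReal_mul (Real.exp_pos _).le, ← Real.exp_add]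
    have hv : (fun j => (((Equiv.funSplitAt i ℤ).symm (k, z) j : ℤ) : ℝ) -
        Function.update c i t j) = w z + Pi.single i ((k : ℝ) - t) := by
      ext j
      by_cases hj : j = i
      · subst hj; simp [hw]
      · simp [hw, hj]
    rw [hv, dotProduct_mulVec_add_single hA]
    congr 2
    simp only [hh]
    field_simp
    ring
  have h0 := key (c i)
  rw [Function.update_eq_self] at h0
  rw [h0, key t, ← ENNReal.tsum_mul_left]
  refine ENNReal.tsum_le_tsum fun z => ?_
  rw [mul_left_comm]
  exact mul_le_mul_right (tsum_ofReal_exp_shifted_sq_le hi hx hx8 _ _) _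

lemma shiftedMass_le {A : Matrix ι ι ℝ} (hA : Aᵀ = A) (hpos : ∀ i, 0 < A i i) {x : ℝ}
    (hx : ∀ i, Real.exp (-Real.pi / A i i) ≤ x) (hx8 : x ≤ 1 / 8) (c d : ι → ℝ) :
    shiftedMass A c ≤ ENNReal.ofReal (1 + 12 * x) ^ Fintype.card ι * shiftedMass A d :=
  le_pow_card_mul_of_update_le
    (fun c i t => shiftedMass_le_update hA (hpos i) (hx i) hx8 c t) c d

end Shifted

/-! ### Negligible functions -/

lemma Negligible.sqrt_mul {n : ℕ → ℕ} (hn : PolynomiallyBounded n) {ε : ℕ → ℝ}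
    (hε : Negligible ε) : Negligible fun κ => √(n κ * ε κ) := by
  obtain ⟨e, he⟩ := hn
  intro d
  have h1 : Filter.Tendsto (fun κ : ℕ => (κ : ℝ) ^ (2 * d) * (n κ * ε κ)) Filter.atTop
      (nhds 0) := by
    -- Pulling `κ ^ d` under the root doubles the degree, and `n = O(κ ^ e)` adds `e`.
    refine Asymptotics.IsBigO.trans_tendsto ?_ (hε (2 * d + e))
    have := ((Asymptotics.isBigO_refl (fun κ : ℕ => (κ : ℝ) ^ (2 * d)) Filter.atTop).mul
      (he.mul (Asymptotics.isBigO_refl ε Filter.atTop)))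
    simpa only [pow_add, mul_assoc] using this
  have h2 := h1.sqrt
  rw [Real.sqrt_zero] at h2
  refine h2.congr fun κ => ?_
  rw [Real.sqrt_mul (by positivity), mul_comm 2 d, pow_mul, Real.sqrt_sq (by positivity)]

/-! ### Statistical distance -/

section StatisticalDistance

variable {α : Type*}

lemma summable_toReal_pmf (P : PMF α) : Summable fun a => (P a).toReal :=
  ENNReal.summable_toReal P.tsum_coe_ne_top

lemma tsum_toReal_pmf (P : PMF α) : ∑' a, (P a).toReal = 1 := by
  rw [← ENNReal.tsum_toReal_eq P.apply_ne_top, P.tsum_coe, ENNReal.toReal_one]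

lemma statisticalDistance_le_of_abs_le {P Q : PMF α} {C : ℝ}
    (h : ∀ a, |(P a).toReal - (Q a).toReal| ≤ C * ((P a).toReal + (Q a).toReal)) :
    statisticalDistance P Q ≤ C := by
  have hs := ((summable_toReal_pmf P).add (summable_toReal_pmf Q)).mul_left C
  have hle := (Summable.of_nonneg_of_le (fun _ => abs_nonneg _) h hs).tsum_le_tsum h hs
  rw [tsum_mul_left, (summable_toReal_pmf P).tsum_add (summable_toReal_pmf Q), tsum_toReal_pmf,
    tsum_toReal_pmf] at hle
  rw [statisticalDistance]
  linarith

lemma statisticalDistance_le_one (P Q : PMF α) : statisticalDistance P Q ≤ 1 := by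
  refine statisticalDistance_le_of_abs_le fun a => ?_
  have h1 : 0 ≤ (P a).toReal := ENNReal.toReal_nonneg
  have h2 : 0 ≤ (Q a).toReal := ENNReal.toReal_nonneg
  rw [abs_le]
  constructor <;> linarith

/-- Summing over `b` uses only that both total masses are `1`. The hypothesis is homogeneous in `P`
and in `Q`, so normalising constants never have to be computed. -/
lemma pmf_le_mul_of_cross_le {P Q : PMF α} {M : ENNReal}
    (h : ∀ a b, P a * Q b ≤ M * (P b * Q a)) (a : α) : P a ≤ M * Q a := by
  calc P a = ∑' b, P a * Q b := by rw [ENNReal.tsum_mul_left, Q.tsum_coe, mul_one]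
    _ ≤ ∑' b, M * (P b * Q a) := ENNReal.tsum_le_tsum (h a)
    _ = M * Q a := by rw [ENNReal.tsum_mul_left, ENNReal.tsum_mul_right, P.tsum_coe, one_mul]

lemma statisticalDistance_le_of_cross_le {P Q : PMF α} {M : ℝ} (hM : 1 ≤ M)
    (h : ∀ a b, P a * Q b ≤ ENNReal.ofReal M * (P b * Q a)) :
    statisticalDistance P Q ≤ M - 1 := by
  have key : ∀ {P Q : PMF α}, (∀ a b, P a * Q b ≤ ENNReal.ofReal M * (P b * Q a)) → ∀ a,
      (P a).toReal ≤ M * (Q a).toReal := by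
    intro P Q h a
    have := ENNReal.toReal_mono (ENNReal.mul_ne_top ENNReal.ofReal_ne_top (Q.apply_ne_top a))
      (pmf_le_mul_of_cross_le h a)
    rwa [ENNReal.toReal_mul, ENNReal.toReal_ofReal (by linarith)] at this
  refine statisticalDistance_le_of_abs_le fun a => ?_
  have h1 := key h a
  have h2 := key (P := Q) (Q := P) (fun a b => by
    rw [mul_comm (Q a), mul_comm (Q b)]; exact h b a) a
  have h3 : 0 ≤ (P a).toReal := ENNReal.toReal_nonneg
  have h4 : 0 ≤ (Q a).toReal := ENNReal.toReal_nonneg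
  rw [abs_le]
  constructor <;> nlinarith

end StatisticalDistance

/-! ### The smoothing parameter of `ℤⁿ` -/

/-- An integer vector as a point of Euclidean space. -/
noncomputable def intVec {n : ℕ} (k : Fin n → ℤ) : EuclideanSpace ℝ (Fin n) :=
  WithLp.toLp 2 fun i => (k i : ℝ)

lemma intVec_injective {n : ℕ} : Function.Injective (intVec (n := n)) := by
  intro k l h
  ext i
  have := congrArg (fun v : EuclideanSpace ℝ (Fin n) => v i) h
  simpa [intVec] using this

lemma dualLattice_integerLattice (n : ℕ) :
    dualLattice (integerLattice n) = Set.range (intVec (n := n)) := by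
  ext y
  constructor
  · rintro ⟨-, hy⟩
    have hi : ∀ i, ∃ k : ℤ, y i = k := by
      intro i
      obtain ⟨k, hk⟩ := hy (EuclideanSpace.basisFun (Fin n) ℝ i)
        (Submodule.subset_span ⟨i, rfl⟩)
      refine ⟨k, ?_⟩
      rw [← hk]
      simp [EuclideanSpace.inner_single_left]
    choose k hk using hi
    refine ⟨k, ?_⟩
    ext i
    simp [intVec, hk]
  · rintro ⟨k, rfl⟩
    constructor
    · have htop : Submodule.span ℝ ((integerLattice n : Set (EuclideanSpace ℝ (Fin n)))) = ⊤ := by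
        rw [eq_top_iff, ← (EuclideanSpace.basisFun (Fin n) ℝ).toBasis.span_eq]
        apply Submodule.span_mono
        rintro _ ⟨i, rfl⟩
        exact Submodule.subset_span ⟨i, by simp⟩
      rw [htop]
      trivial
    · intro x hx
      induction hx using Submodule.span_induction with
      | mem x hx =>
        obtain ⟨i, rfl⟩ := hx
        exact ⟨k i, by simp [intVec, EuclideanSpace.inner_single_left]⟩
      | zero => exact ⟨0, by simp⟩
      | add x y _ _ hx hy =>
        obtain ⟨a, ha⟩ := hx
        obtain ⟨b, hb⟩ := hy
        exact ⟨a + b, by rw [inner_add_left, ha, hb]; push_cast; rfl⟩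
      | smul c x _ hx =>
        obtain ⟨a, ha⟩ := hx
        refine ⟨c * a, ?_⟩
        rw [← Int.cast_smul_eq_zsmul ℝ c x, inner_smul_left, ha]
        simp

lemma rhoMass_dualLattice_integerLattice (n : ℕ) (s : ℝ) :
    rhoMass s (dualLattice (integerLattice n)) =
      ∑' k : Fin n → ℤ, ENNReal.ofReal (Real.exp (-Real.pi * (s ^ 2 * ∑ i, (k i : ℝ) ^ 2))) := by
  rw [rhoMass, dualLattice_integerLattice,
    tsum_range (fun y => ENNReal.ofReal (rho (s • y))) intVec_injective]
  refine tsum_congr fun k => ?_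
  rw [rho, inner_smul_left, inner_smul_right, real_inner_self_eq_norm_sq,
    EuclideanSpace.real_norm_sq_eq]
  simp only [intVec, conj_trivial]
  congr 3
  ring

/-- The origin and the `n` unit vectors alone contribute `1 + n exp(-π s²)`. -/
lemma nat_mul_exp_le_of_rhoMass_le {n : ℕ} {s ε : ℝ} (hε : 0 < ε)
    (h : rhoMass s (dualLattice (integerLattice n)) ≤ ENNReal.ofReal (1 + ε)) :
    n * Real.exp (-Real.pi * s ^ 2) ≤ ε := by
  rw [rhoMass_dualLattice_integerLattice] at h
  let g : Option (Fin n) → Fin n → ℤ := fun o => o.elim 0 fun i => Pi.single i 1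
  have hg : Function.Injective g := by
    rintro (_ | i) (_ | j) hij
    · rfl
    · have := congrFun hij j
      simp [g] at this
    · have := congrFun hij i
      simp [g] at this
    · have := congrFun hij i
      by_cases hne : i = j
      · rw [hne]
      · simp [g, hne] at this
  have h2 := (ENNReal.tsum_comp_le_tsum_of_injective hg _).trans h
  have hsq : ∀ i : Fin n, ∑ j, ((g (some i) j : ℤ) : ℝ) ^ 2 = 1 := by
    intro i
    rw [Finset.sum_eq_single i]
    · simp [g]
    · intro j _ hj
      simp [g, hj]
    · simp
  rw [tsum_fintype, Fintype.sum_option] at h2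
  simp only [hsq, mul_one] at h2
  have h0 : ∑ j, ((g none j : ℤ) : ℝ) ^ 2 = 0 := by simp [g]
  rw [h0, mul_zero, mul_zero, Real.exp_zero, Finset.sum_const, Finset.card_univ, Fintype.card_fin,
    ← ENNReal.ofReal_nsmul, ← ENNReal.ofReal_add zero_le_one (by positivity),
    ENNReal.ofReal_le_ofReal_iff (by positivity), nsmul_eq_mul] at h2
  linarith

/-- This ensures that the infimum defining `η_ε` is not the default value `sInf ∅ = 0`. With `s² = 1
+ C/ε`, every nonzero `k` has `|k|² ≥ 1`, so its term gains a factor `exp(-π C/ε)`, and `C exp(-π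
C/ε) ≤ ε`. -/
lemma exists_rhoMass_le (n : ℕ) {ε : ℝ} (hε : 0 < ε) :
    ∃ s : ℝ, 0 < s ∧ rhoMass s (dualLattice (integerLattice n)) ≤ ENNReal.ofReal (1 + ε) := by
  have hsum := summable_gaussianWeight (Matrix.PosDef.one (n := Fin n) (R := ℝ))
  set C := ∑' k, gaussianWeight (1 : Matrix (Fin n) (Fin n) ℝ) k with hC
  have hC0 : 0 ≤ C := tsum_nonneg fun _ => (Real.exp_pos _).le
  have hs : 0 ≤ C / ε := div_nonneg hC0 hε.le
  refine ⟨√(1 + C / ε), Real.sqrt_pos.mpr (by linarith), ?_⟩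
  rw [rhoMass_dualLattice_integerLattice, Real.sq_sqrt (by linarith)]
  have hpt : ∀ k : Fin n → ℤ, Real.exp (-Real.pi * ((1 + C / ε) * ∑ i, (k i : ℝ) ^ 2)) ≤
      (if k = 0 then 1 else 0) +
        Real.exp (-Real.pi * (C / ε)) * gaussianWeight (1 : Matrix (Fin n) (Fin n) ℝ) k := by
    intro k
    by_cases hk : k = 0
    · have : 0 ≤ Real.exp (-Real.pi * (C / ε)) *
          gaussianWeight (1 : Matrix (Fin n) (Fin n) ℝ) k :=
        mul_nonneg (Real.exp_pos _).le (Real.exp_pos _).le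
      rw [if_pos hk]
      refine le_trans ?_ (le_add_of_nonneg_right this)
      simp [hk]
    · rw [if_neg hk, zero_add, gaussianWeight, ← Real.exp_add]
      apply Real.exp_le_exp.mpr
      have hw : ((fun i => (k i : ℝ)) ⬝ᵥ
          ((1 : Matrix (Fin n) (Fin n) ℝ)⁻¹ *ᵥ fun i => (k i : ℝ))) = ∑ i, (k i : ℝ) ^ 2 := by
        rw [inv_one, one_mulVec, dotProduct]
        exact Finset.sum_congr rfl fun i _ => (sq _).symm
      rw [hw]
      obtain ⟨i, hi⟩ := Function.ne_iff.mp hk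
      have h1 : (1 : ℝ) ≤ ∑ i, (k i : ℝ) ^ 2 := by
        refine le_trans ?_ (Finset.single_le_sum (f := fun i => (k i : ℝ) ^ 2)
          (fun _ _ => sq_nonneg _) (Finset.mem_univ i))
        have : (1 : ℤ) ≤ k i ^ 2 := Int.one_le_abs (pow_ne_zero 2 hi) |>.trans_eq
          (abs_of_nonneg (sq_nonneg _))
        exact_mod_cast this
      have h2 : 0 ≤ Real.pi * (C / ε) := by positivity
      nlinarith
  have hsum2 : Summable fun k : Fin n → ℤ => (if k = 0 then (1 : ℝ) else 0) +
        Real.exp (-Real.pi * (C / ε)) * gaussianWeight (1 : Matrix (Fin n) (Fin n) ℝ) k :=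
    (hasSum_ite_eq 0 1).summable.add (hsum.mul_left _)
  refine (ENNReal.tsum_le_tsum fun k => ENNReal.ofReal_le_ofReal (hpt k)).trans ?_
  rw [← ENNReal.ofReal_tsum_of_nonneg
    (fun k => (Real.exp_pos _).le.trans (hpt k)) hsum2]
  apply ENNReal.ofReal_le_ofReal
  rw [(hasSum_ite_eq (0 : Fin n → ℤ) (1 : ℝ)).summable.tsum_add (hsum.mul_left _), tsum_ite_eq,
    tsum_mul_left, ← hC, add_le_add_iff_left]
  have h1 : C / ε ≤ Real.exp (Real.pi * (C / ε)) := by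
    have := Real.add_one_le_exp (Real.pi * (C / ε))
    nlinarith [Real.pi_gt_three]
  rw [neg_mul, Real.exp_neg, inv_mul_le_iff₀ (Real.exp_pos _)]
  rwa [div_le_iff₀ hε] at h1

lemma nat_mul_exp_smoothingParameter_le (n : ℕ) {ε : ℝ} (hε : 0 < ε) :
    n * Real.exp (-Real.pi * smoothingParameter (integerLattice n) ε ^ 2) ≤ ε := by
  have hbdd : BddBelow {s : ℝ | 0 < s ∧
      rhoMass s (dualLattice (integerLattice n)) ≤ ENNReal.ofReal (1 + ε)} :=
    ⟨0, fun s hs => hs.1.le⟩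
  have hmem := csInf_mem_closure (exists_rhoMass_le n hε) hbdd
  -- The bound is a closed condition, so it passes to the infimum whether or not this is attained.
  have hclosed : IsClosed {s : ℝ | n * Real.exp (-Real.pi * s ^ 2) ≤ ε} :=
    isClosed_le (by fun_prop) continuous_const
  exact closure_minimal (fun s hs => nat_mul_exp_le_of_rhoMass_le hε hs.2) hclosed hmem

lemma smoothingParameter_nonneg (n : ℕ) (ε : ℝ) :
    0 ≤ smoothingParameter (integerLattice n) ε :=
  Real.sInf_nonneg fun _ hs => hs.1.le

lemma smoothingParameter_pos {n : ℕ} (hn : 0 < n) {ε : ℝ} (hε : 0 < ε) (hε1 : ε < 1) :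
    0 < smoothingParameter (integerLattice n) ε := by
  refine (smoothingParameter_nonneg n ε).lt_of_ne fun h => ?_
  have h1 := nat_mul_exp_smoothingParameter_le n hε
  rw [← h] at h1
  have h2 : (1 : ℝ) ≤ n := by exact_mod_cast hn
  simp at h1
  linarith

/-! ### Discrete Gaussians as probability mass functions -/

lemma bind_map_add_apply {ι ι' : Type*} (P : PMF (ι → ℤ)) (Q : PMF (ι' → ℤ)) (g : (ι' → ℤ) → ι → ℤ)
    (y : ι → ℤ) :
    (P.bind fun p => Q.map fun x => p + g x) y = ∑' x, P (y - g x) * Q x := by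
  rw [PMF.bind_apply]
  simp_rw [PMF.map_apply, ← ENNReal.tsum_mul_left]
  rw [ENNReal.tsum_comm]
  refine tsum_congr fun x => ?_
  rw [tsum_eq_single (y - g x)]
  · simp
  · intro p hp
    rw [if_neg, mul_zero]
    rintro rfl
    simp at hp

section Pmf

variable {ι ι' : Type*} [Fintype ι] [Fintype ι']

lemma posDef_fromBlocks_diagonal {S : Matrix ι ι ℝ} {R : Matrix ι' ι' ℝ} (hS : S.PosDef)
    (hR : R.PosDef) : (fromBlocks S 0 0 R).PosDef := by
  refine .of_dotProduct_mulVec_pos ?_ fun x hx => ?_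
  · rw [IsHermitian, fromBlocks_conjTranspose, hS.1.eq, hR.1.eq, conjTranspose_zero,
      conjTranspose_zero]
  · have hx' : x = Sum.elim (x ∘ Sum.inl) (x ∘ Sum.inr) := (Sum.elim_comp_inl_inr x).symm
    set p := x ∘ Sum.inl
    set q := x ∘ Sum.inr
    have hval : star x ⬝ᵥ (fromBlocks S 0 0 R *ᵥ x) = star p ⬝ᵥ (S *ᵥ p) + star q ⬝ᵥ (R *ᵥ q) := by
      rw [star_trivial, star_trivial, star_trivial, hx', fromBlocks_mulVec]
      simp
    rw [hval]
    by_cases hp : p = 0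
    · have hq : q ≠ 0 := by
        rintro hq
        apply hx
        rw [hx', hp, hq]
        ext (i | i) <;> rfl
      rw [hp]
      simpa using hR.dotProduct_mulVec_pos hq
    · exact add_pos_of_pos_of_nonneg (hS.dotProduct_mulVec_pos hp)
        (hR.posSemidef.dotProduct_mulVec_nonneg q)

variable [DecidableEq ι] [DecidableEq ι']

lemma discreteGaussian_apply {S : Matrix ι ι ℝ} (hS : S.PosDef) (x : ι → ℤ) :
    discreteGaussian S x = ENNReal.ofReal (gaussianWeight S x) *
      (∑' y, ENNReal.ofReal (gaussianWeight S y))⁻¹ := by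
  rw [discreteGaussian, dif_pos hS, PMF.normalize_apply]

lemma gaussianWeight_nonneg (S : Matrix ι ι ℝ) (x : ι → ℤ) : 0 ≤ gaussianWeight S x :=
  (Real.exp_pos _).le

lemma gaussianWeight_fromBlocks {S : Matrix ι ι ℝ} {R : Matrix ι' ι' ℝ} (hS : S.PosDef)
    (hR : R.PosDef) (p : ι → ℤ) (x : ι' → ℤ) :
    gaussianWeight (fromBlocks S 0 0 R) (Sum.elim p x) =
      gaussianWeight S p * gaussianWeight R x := by
  have hinv : (fromBlocks S 0 0 R)⁻¹ = fromBlocks S⁻¹ 0 0 R⁻¹ := by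
    apply inv_eq_right_inv
    rw [fromBlocks_multiply]
    simp [mul_nonsing_inv _ ((isUnit_iff_isUnit_det _).mp hS.isUnit),
      mul_nonsing_inv _ ((isUnit_iff_isUnit_det _).mp hR.isUnit)]
  have hv : (fun i => ((Sum.elim p x i : ℤ) : ℝ)) =
      Sum.elim (fun i => (p i : ℝ)) (fun i => (x i : ℝ)) := by
    ext (i | i) <;> rfl
  rw [gaussianWeight, gaussianWeight, gaussianWeight, hinv, hv, fromBlocks_mulVec, ← Real.exp_add]
  simp [mul_add]

lemma discreteGaussian_fromBlocks {S : Matrix ι ι ℝ} {R : Matrix ι' ι' ℝ} (hS : S.PosDef)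
    (hR : R.PosDef) :
    discreteGaussian (fromBlocks S 0 0 R) =
      (discreteGaussian S).bind fun p => (discreteGaussian R).map fun x => Sum.elim p x := by
  ext z
  obtain ⟨p, x, rfl⟩ : ∃ p x, z = Sum.elim p x :=
    ⟨z ∘ Sum.inl, z ∘ Sum.inr, (Sum.elim_comp_inl_inr z).symm⟩
  have hmass : ∑' y, ENNReal.ofReal (gaussianWeight (fromBlocks S 0 0 R) y) =
      (∑' y, ENNReal.ofReal (gaussianWeight S y)) *
        ∑' y, ENNReal.ofReal (gaussianWeight R y) := by
    rw [← (Equiv.sumArrowEquivProdArrow ι ι' ℤ).symm.tsum_eq, ENNReal.tsum_prod',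
      ← ENNReal.tsum_mul_right]
    refine tsum_congr fun a => ?_
    rw [← ENNReal.tsum_mul_left]
    refine tsum_congr fun b => ?_
    rw [← ENNReal.ofReal_mul (gaussianWeight_nonneg S a), ← gaussianWeight_fromBlocks hS hR]
    rfl
  have hbind : ((discreteGaussian S).bind fun p => (discreteGaussian R).map fun x => Sum.elim p x)
      (Sum.elim p x) = discreteGaussian S p * discreteGaussian R x := by
    rw [PMF.bind_apply, tsum_eq_single p, PMF.map_apply, tsum_eq_single x, if_pos rfl]
    · intro x' hx'
      rw [if_neg]
      intro h
      apply hx'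
      ext i
      exact (congrFun h (Sum.inr i)).symm
    · intro p' hp'
      rw [PMF.map_apply, ENNReal.tsum_eq_zero.mpr, mul_zero]
      intro x'
      rw [if_neg]
      intro h
      apply hp'
      ext i
      exact (congrFun h (Sum.inl i)).symm
  rw [hbind, discreteGaussian_apply (posDef_fromBlocks_diagonal hS hR),
    gaussianWeight_fromBlocks hS hR, hmass, discreteGaussian_apply hS, discreteGaussian_apply hR,
    ENNReal.ofReal_mul (gaussianWeight_nonneg S p),
    ENNReal.mul_inv (Or.inl (tsum_gaussianWeight_ne_zero S))
      (Or.inl (tsum_gaussianWeight_ne_top hS))]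
  ring

end Pmf

/-! ### Norm bounds -/

section Norms

variable {m n : ℕ}

lemma dotProduct_self_eq_norm_sq (v : Fin m → ℝ) : v ⬝ᵥ v = ‖WithLp.toLp 2 v‖ ^ 2 := by
  rw [EuclideanSpace.real_norm_sq_eq, dotProduct]
  exact Finset.sum_congr rfl fun i _ => (sq _).symm

lemma dotProduct_mulVec_self_le (A : Matrix (Fin m) (Fin n) ℝ) (v : Fin n → ℝ) :
    (A *ᵥ v) ⬝ᵥ (A *ᵥ v) ≤ largestSingularValue A ^ 2 * (v ⬝ᵥ v) := by
  rw [dotProduct_self_eq_norm_sq, dotProduct_self_eq_norm_sq, ← mul_pow]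
  refine pow_le_pow_left₀ (norm_nonneg _) ?_ 2
  exact (Matrix.toEuclideanLin A).toContinuousLinearMap.le_opNorm (WithLp.toLp 2 v)

/-- For `w = Aᵗ v`, Cauchy–Schwarz gives `|w|⁴ = ⟪v, A w⟫² ≤ |v|² s₁(A)² |w|²`; then divide by
`|w|²`. -/
lemma dotProduct_transpose_mulVec_self_le (A : Matrix (Fin m) (Fin n) ℝ) (v : Fin m → ℝ) :
    (Aᵀ *ᵥ v) ⬝ᵥ (Aᵀ *ᵥ v) ≤ largestSingularValue A ^ 2 * (v ⬝ᵥ v) := by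
  set w := Aᵀ *ᵥ v with hw
  have h1 : w ⬝ᵥ w = v ⬝ᵥ (A *ᵥ w) := by
    rw [dotProduct_mulVec v A w, ← mulVec_transpose]
  have h2 : (v ⬝ᵥ (A *ᵥ w)) ^ 2 ≤ (v ⬝ᵥ v) * ((A *ᵥ w) ⬝ᵥ (A *ᵥ w)) := by
    have := Finset.sum_mul_sq_le_sq_mul_sq Finset.univ v (A *ᵥ w)
    simpa only [dotProduct, sq] using this
  have h3 := dotProduct_mulVec_self_le A w
  have hv : 0 ≤ v ⬝ᵥ v := by rw [dotProduct_self_eq_norm_sq]; positivity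
  have hw0 : 0 ≤ w ⬝ᵥ w := by rw [dotProduct_self_eq_norm_sq]; positivity
  rw [← h1] at h2
  obtain h0 | hpos := hw0.eq_or_lt
  · rw [← h0]
    exact mul_nonneg (sq_nonneg _) hv
  · refine le_of_mul_le_mul_right ?_ hpos
    have := h2.trans (mul_le_mul_of_nonneg_left h3 hv)
    linarith

lemma dotProduct_inv_mulVec_le {S : Matrix (Fin m) (Fin m) ℝ} (hS : S.PosDef) {l : ℝ} (hl : 0 < l)
    (h : ∀ u : Fin m → ℝ, l * (u ⬝ᵥ u) ≤ u ⬝ᵥ (S *ᵥ u)) (v : Fin m → ℝ) :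
    v ⬝ᵥ (S⁻¹ *ᵥ v) ≤ (v ⬝ᵥ v) / l := by
  set u := S⁻¹ *ᵥ v with hu
  have hSu : S *ᵥ u = v := by
    rw [hu, mulVec_mulVec, mul_nonsing_inv _ ((isUnit_iff_isUnit_det _).mp hS.isUnit), one_mulVec]
  have h1 := h u
  rw [hSu, dotProduct_comm u v] at h1
  -- Expanding the square and using `l |u|² ≤ ⟪u, v⟫` leaves `l ⟪u, v⟫ ≤ |v|²`.
  have h2 : 0 ≤ (v - l • u) ⬝ᵥ (v - l • u) := by rw [dotProduct_self_eq_norm_sq]; positivity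
  simp only [sub_dotProduct, dotProduct_sub, smul_dotProduct, dotProduct_smul, smul_eq_mul,
    dotProduct_comm u v] at h2
  rw [le_div_iff₀ hl]
  nlinarith

end Norms

/-! ### The convolution -/

section Convolution

variable {m n : ℕ} {T : Matrix (Fin m) (Fin n) ℤ} {r s : ℝ}

lemma dotProduct_perturbationCov_mulVec (u : Fin m → ℝ) :
    u ⬝ᵥ (perturbationCov T r s *ᵥ u) = s ^ 2 * (u ⬝ᵥ u) -
      r ^ 2 * (((realMatrix T)ᵀ *ᵥ u) ⬝ᵥ ((realMatrix T)ᵀ *ᵥ u)) := by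
  rw [perturbationCov, sub_mulVec, smul_mulVec, smul_mulVec, one_mulVec, dotProduct_sub,
    dotProduct_smul, dotProduct_smul, ← mulVec_mulVec, dotProduct_mulVec u (realMatrix T),
    ← mulVec_transpose, smul_eq_mul, smul_eq_mul]

lemma mul_dotProduct_self_le_perturbationCov {l : ℝ}
    (hl : l + r ^ 2 * largestSingularValue (realMatrix T) ^ 2 ≤ s ^ 2) (u : Fin m → ℝ) :
    l * (u ⬝ᵥ u) ≤ u ⬝ᵥ (perturbationCov T r s *ᵥ u) := by
  rw [dotProduct_perturbationCov_mulVec]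
  have h1 := mul_le_mul_of_nonneg_left (dotProduct_transpose_mulVec_self_le (realMatrix T) u)
    (sq_nonneg r)
  have h2 : 0 ≤ u ⬝ᵥ u := by rw [dotProduct_self_eq_norm_sq]; positivity
  nlinarith [mul_le_mul_of_nonneg_right hl h2]

lemma transpose_perturbationCov : (perturbationCov T r s)ᵀ = perturbationCov T r s := by
  simp [perturbationCov]

lemma posDef_perturbationCov {l : ℝ} (hl0 : 0 < l)
    (hl : l + r ^ 2 * largestSingularValue (realMatrix T) ^ 2 ≤ s ^ 2) :
    (perturbationCov T r s).PosDef := by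
  refine .of_dotProduct_mulVec_pos ?_ fun u hu => ?_
  · rw [IsHermitian, conjTranspose_eq_transpose_of_trivial, transpose_perturbationCov]
  · rw [star_trivial]
    refine lt_of_lt_of_le (mul_pos hl0 ?_) (mul_dotProduct_self_le_perturbationCov hl u)
    exact lt_of_le_of_ne (by rw [dotProduct_self_eq_norm_sq]; positivity)
      fun h => hu (dotProduct_self_eq_zero.mp h.symm)

lemma posDef_sq_smul_one {k : ℕ} {t : ℝ} (ht : 0 < t) :
    (t ^ 2 • (1 : Matrix (Fin k) (Fin k) ℝ)).PosDef :=
  Matrix.PosDef.one.smul (by positivity)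

lemma map_convolutionMatrix_discreteGaussian (hS : (perturbationCov T r s).PosDef) (hr : 0 < r) :
    (discreteGaussian (jointCov T r s)).map (fun x => (convolutionMatrix T).mulVec x) =
      ((discreteGaussian (perturbationCov T r s)).bind fun p =>
        (discreteGaussian (r ^ 2 • (1 : Matrix (Fin n) (Fin n) ℝ))).map fun x' =>
          p + T.mulVec x') := by
  rw [jointCov, discreteGaussian_fromBlocks hS (posDef_sq_smul_one hr), PMF.map_bind]
  congr 1
  ext1 p
  rw [PMF.map_comp]
  congr 1
  ext1 x
  simp [convolutionMatrix, fromCols_mulVec]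

/-- The inverse of the covariance of `x'` conditioned on `p + T x'`. -/
noncomputable def conditionalPrecision (T : Matrix (Fin m) (Fin n) ℤ) (r s : ℝ) :
    Matrix (Fin n) (Fin n) ℝ :=
  (r ^ 2)⁻¹ • 1 + (realMatrix T)ᵀ * (perturbationCov T r s)⁻¹ * realMatrix T

lemma dotProduct_conditionalPrecision_mulVec (z : Fin n → ℝ) :
    z ⬝ᵥ (conditionalPrecision T r s *ᵥ z) = (r ^ 2)⁻¹ * (z ⬝ᵥ z) +
      (realMatrix T *ᵥ z) ⬝ᵥ ((perturbationCov T r s)⁻¹ *ᵥ (realMatrix T *ᵥ z)) := by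
  rw [conditionalPrecision, add_mulVec, dotProduct_add, smul_mulVec, one_mulVec, dotProduct_smul,
    smul_eq_mul, Matrix.mul_assoc, ← mulVec_mulVec, ← mulVec_mulVec, dotProduct_mulVec,
    vecMul_transpose]

lemma transpose_conditionalPrecision :
    (conditionalPrecision T r s)ᵀ = conditionalPrecision T r s := by
  simp [conditionalPrecision, transpose_nonsing_inv, transpose_perturbationCov, Matrix.mul_assoc]

lemma conditionalPrecision_apply_self (i : Fin n) :
    conditionalPrecision T r s i i = (r ^ 2)⁻¹ + (realMatrix T *ᵥ Pi.single i 1) ⬝ᵥ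
      ((perturbationCov T r s)⁻¹ *ᵥ (realMatrix T *ᵥ Pi.single i 1)) := by
  have h := dotProduct_conditionalPrecision_mulVec (T := T) (r := r) (s := s) (Pi.single i 1)
  rw [single_dotProduct, one_mul, single_dotProduct, Pi.single_eq_same, one_mul, mul_one] at h
  rw [← h]
  simp [mulVec_single]

lemma gaussianWeight_sq_smul_one {k : ℕ} {t : ℝ} (ht : 0 < t) (x : Fin k → ℤ) :
    gaussianWeight (t ^ 2 • (1 : Matrix (Fin k) (Fin k) ℝ)) x =
      Real.exp (-Real.pi * ((t ^ 2)⁻¹ * ((fun i => (x i : ℝ)) ⬝ᵥ fun i => (x i : ℝ)))) := by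
  have hinv : (t ^ 2 • (1 : Matrix (Fin k) (Fin k) ℝ))⁻¹ = (t ^ 2)⁻¹ • 1 := by
    apply inv_eq_right_inv
    have : t ^ 2 ≠ 0 := by positivity
    simp [smul_smul, this]
  rw [gaussianWeight, hinv, smul_mulVec, one_mulVec, dotProduct_smul, smul_eq_mul]

lemma complete_square (hS : (perturbationCov T r s).PosDef) (hr : 0 < r) (hs : 0 < s)
    (y : Fin m → ℝ) (x : Fin n → ℝ) :
    (y - realMatrix T *ᵥ x) ⬝ᵥ ((perturbationCov T r s)⁻¹ *ᵥ (y - realMatrix T *ᵥ x)) +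
      (r ^ 2)⁻¹ * (x ⬝ᵥ x) =
    (s ^ 2)⁻¹ * (y ⬝ᵥ y) + (x - (r ^ 2 / s ^ 2) • ((realMatrix T)ᵀ *ᵥ y)) ⬝ᵥ
      (conditionalPrecision T r s *ᵥ (x - (r ^ 2 / s ^ 2) • ((realMatrix T)ᵀ *ᵥ y))) := by
  set M := realMatrix T
  set S := perturbationCov T r s with hSdef
  set w := Mᵀ *ᵥ y with hw
  set z := x - (r ^ 2 / s ^ 2) • w with hz
  have hdet := (isUnit_iff_isUnit_det _).mp hS.isUnit
  have hx : x = z + (r ^ 2 / s ^ 2) • w := by rw [hz]; abel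
  clear_value z
  have hs2 : s ^ 2 ≠ 0 := by positivity
  have hr2 : r ^ 2 ≠ 0 := by positivity
  have hSy : S *ᵥ y = s ^ 2 • y - r ^ 2 • (M *ᵥ w) := by
    rw [hSdef, perturbationCov, sub_mulVec, smul_mulVec, smul_mulVec, one_mulVec, ← mulVec_mulVec]
  -- In this form `S⁻¹` cancels against `S y`, and the terms in `⟪w, z⟫` from the two summands
  -- cancel.
  have hy : y - M *ᵥ x = (s ^ 2)⁻¹ • (S *ᵥ y) - M *ᵥ z := by
    rw [hSy, hx, mulVec_add, mulVec_smul, smul_sub, smul_smul, smul_smul, inv_mul_cancel₀ hs2,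
      one_smul, div_eq_inv_mul]
    abel
  have hinv : S⁻¹ *ᵥ (S *ᵥ y) = y := by
    rw [mulVec_mulVec, nonsing_inv_mul _ hdet, one_mulVec]
  have hcross : (S *ᵥ y) ⬝ᵥ (S⁻¹ *ᵥ (M *ᵥ z)) = w ⬝ᵥ z := by
    rw [dotProduct_mulVec, ← mulVec_transpose, transpose_nonsing_inv, hSdef,
      transpose_perturbationCov, ← hSdef, hinv, dotProduct_mulVec, ← mulVec_transpose]
  have hcross2 : (M *ᵥ z) ⬝ᵥ y = w ⬝ᵥ z := by
    rw [dotProduct_comm, dotProduct_mulVec, ← mulVec_transpose]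
  have hyy : (S *ᵥ y) ⬝ᵥ y = s ^ 2 * (y ⬝ᵥ y) - r ^ 2 * (w ⬝ᵥ w) := by
    rw [dotProduct_comm, hSdef, dotProduct_perturbationCov_mulVec]
  rw [dotProduct_conditionalPrecision_mulVec, ← hSdef, hy, mulVec_sub, mulVec_smul, hinv, hx]
  simp only [sub_dotProduct, dotProduct_sub, add_dotProduct, dotProduct_add, smul_dotProduct,
    dotProduct_smul, smul_eq_mul, hcross, hcross2, hyy, dotProduct_comm z w]
  field_simp
  ring

lemma gaussianWeight_sub_mul_gaussianWeight (hS : (perturbationCov T r s).PosDef) (hr : 0 < r)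
    (hs : 0 < s) (y : Fin m → ℤ) (x : Fin n → ℤ) :
    gaussianWeight (perturbationCov T r s) (y - T *ᵥ x) *
        gaussianWeight (r ^ 2 • (1 : Matrix (Fin n) (Fin n) ℝ)) x =
      gaussianWeight (s ^ 2 • (1 : Matrix (Fin m) (Fin m) ℝ)) y *
        Real.exp (-Real.pi * ((fun j => (x j : ℝ) -
            ((r ^ 2 / s ^ 2) • ((realMatrix T)ᵀ *ᵥ fun i => (y i : ℝ))) j) ⬝ᵥ
          (conditionalPrecision T r s *ᵥ fun j => (x j : ℝ) -
            ((r ^ 2 / s ^ 2) • ((realMatrix T)ᵀ *ᵥ fun i => (y i : ℝ))) j))) := by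
  have hv : (fun i => (((y - T *ᵥ x) i : ℤ) : ℝ)) =
      (fun i => (y i : ℝ)) - realMatrix T *ᵥ fun j => (x j : ℝ) := by
    ext i
    simp [mulVec, dotProduct, realMatrix]
  rw [gaussianWeight_sq_smul_one hr, gaussianWeight_sq_smul_one hs, gaussianWeight, hv,
    ← Real.exp_add, ← Real.exp_add, ← mul_add, ← mul_add, complete_square hS hr hs]
  rfl

lemma bind_map_discreteGaussian_apply (hS : (perturbationCov T r s).PosDef) (hr : 0 < r)
    (hs : 0 < s) : ∃ K : ENNReal, ∀ y : Fin m → ℤ,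
    ((discreteGaussian (perturbationCov T r s)).bind fun p =>
      (discreteGaussian (r ^ 2 • (1 : Matrix (Fin n) (Fin n) ℝ))).map fun x' =>
        p + T.mulVec x') y =
      K * (discreteGaussian (s ^ 2 • (1 : Matrix (Fin m) (Fin m) ℝ)) y *
        shiftedMass (conditionalPrecision T r s)
          ((r ^ 2 / s ^ 2) • ((realMatrix T)ᵀ *ᵥ fun i => (y i : ℝ)))) := by
  have hS' := posDef_sq_smul_one (k := m) hs
  have hR' := posDef_sq_smul_one (k := n) hr
  set ZS := ∑' y, ENNReal.ofReal (gaussianWeight (s ^ 2 • (1 : Matrix (Fin m) (Fin m) ℝ)) y)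
    with hZS
  set Zp := ∑' y, ENNReal.ofReal (gaussianWeight (perturbationCov T r s) y) with hZp
  set Zr := ∑' y, ENNReal.ofReal (gaussianWeight (r ^ 2 • (1 : Matrix (Fin n) (Fin n) ℝ)) y)
    with hZr
  refine ⟨ZS * (Zp⁻¹ * Zr⁻¹), fun y => ?_⟩
  rw [bind_map_add_apply, discreteGaussian_apply hS', ← hZS, shiftedMass]
  have hcancel : ZS * ZS⁻¹ = 1 :=
    ENNReal.mul_inv_cancel (tsum_gaussianWeight_ne_zero _) (tsum_gaussianWeight_ne_top hS')
  have hre : ∀ a b F : ENNReal, ZS * b * (a * ZS⁻¹ * F) = b * (a * F) := by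
    intro a b F
    calc ZS * b * (a * ZS⁻¹ * F) = (ZS * ZS⁻¹) * (b * (a * F)) := by ring
      _ = b * (a * F) := by rw [hcancel, one_mul]
  rw [hre, ← ENNReal.tsum_mul_left, ← ENNReal.tsum_mul_left]
  refine tsum_congr fun x => ?_
  rw [← ENNReal.ofReal_mul (gaussianWeight_nonneg _ y),
    ← gaussianWeight_sub_mul_gaussianWeight hS hr hs, discreteGaussian_apply hS,
    discreteGaussian_apply hR', ENNReal.ofReal_mul (gaussianWeight_nonneg _ (y - T *ᵥ x))]
  ring

lemma conditionalPrecision_apply_self_pos (hS : (perturbationCov T r s).PosDef) (hr : 0 < r)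
    (i : Fin n) : 0 < conditionalPrecision T r s i i := by
  rw [conditionalPrecision_apply_self]
  have := hS.inv.posSemidef.dotProduct_mulVec_nonneg (realMatrix T *ᵥ Pi.single i 1)
  rw [star_trivial] at this
  positivity

lemma statisticalDistance_bind_map_discreteGaussian_le (hS : (perturbationCov T r s).PosDef)
    (hr : 0 < r) (hs : 0 < s) {x : ℝ} (hx0 : 0 ≤ x)
    (hx : ∀ i, Real.exp (-Real.pi / conditionalPrecision T r s i i) ≤ x) (hx8 : x ≤ 1 / 8) :
    statisticalDistance
      ((discreteGaussian (perturbationCov T r s)).bind fun p =>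
        (discreteGaussian (r ^ 2 • (1 : Matrix (Fin n) (Fin n) ℝ))).map fun x' =>
          p + T.mulVec x')
      (discreteGaussian (s ^ 2 • (1 : Matrix (Fin m) (Fin m) ℝ))) ≤ (1 + 12 * x) ^ n - 1 := by
  obtain ⟨K, hK⟩ := bind_map_discreteGaussian_apply hS hr hs
  refine statisticalDistance_le_of_cross_le (one_le_pow₀ (by linarith)) fun a b => ?_
  rw [hK a, hK b, ENNReal.ofReal_pow (by linarith)]
  set D := discreteGaussian (s ^ 2 • (1 : Matrix (Fin m) (Fin m) ℝ))
  have hle := shiftedMass_le transpose_conditionalPrecision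
    (conditionalPrecision_apply_self_pos hS hr) hx hx8
    ((r ^ 2 / s ^ 2) • ((realMatrix T)ᵀ *ᵥ fun i => (a i : ℝ)))
    ((r ^ 2 / s ^ 2) • ((realMatrix T)ᵀ *ᵥ fun i => (b i : ℝ)))
  rw [Fintype.card_fin] at hle
  calc _ = (K * D a * D b) * shiftedMass (conditionalPrecision T r s)
        ((r ^ 2 / s ^ 2) • ((realMatrix T)ᵀ *ᵥ fun i => (a i : ℝ))) := by ring
    _ ≤ (K * D a * D b) * _ := mul_le_mul_right hle _
    _ = _ := by ring

/-- Each of the two summands of the diagonal entry is at most `1/η²`: the first as `η ≤ r`, the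
second as `|T eᵢ| ≤ σ` and `Σ_p ≥ (r² + η² (σ² + 1)) I`, which is what the bound on `s²` leaves
after subtracting `r² σ²`. -/
lemma conditionalPrecision_apply_self_le (hr : 0 < r) {η : ℝ} (hη : 0 < η) (hηr : η ≤ r)
    (h : (r ^ 2 + η ^ 2) * (largestSingularValue (realMatrix T) ^ 2 + 1) ≤ s ^ 2) (i : Fin n) :
    conditionalPrecision T r s i i ≤ 2 / η ^ 2 := by
  set σ := largestSingularValue (realMatrix T) with hσ
  have hl0 : 0 < r ^ 2 + η ^ 2 * (σ ^ 2 + 1) := by positivity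
  have hl : r ^ 2 + η ^ 2 * (σ ^ 2 + 1) + r ^ 2 * σ ^ 2 ≤ s ^ 2 := by linarith
  have h1 := dotProduct_inv_mulVec_le (posDef_perturbationCov hl0 hl) hl0
    (mul_dotProduct_self_le_perturbationCov hl) (realMatrix T *ᵥ Pi.single i 1)
  have h2 := dotProduct_mulVec_self_le (realMatrix T) (Pi.single i 1)
  rw [← hσ, single_dotProduct, Pi.single_eq_same, mul_one, mul_one] at h2
  have h3 : σ ^ 2 / (r ^ 2 + η ^ 2 * (σ ^ 2 + 1)) ≤ (η ^ 2)⁻¹ := by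
    rw [div_le_iff₀ hl0, ← div_eq_inv_mul, le_div_iff₀ (by positivity)]
    nlinarith [sq_nonneg r, sq_nonneg η]
  have h4 : (r ^ 2)⁻¹ ≤ (η ^ 2)⁻¹ := by gcongr
  rw [conditionalPrecision_apply_self]
  have h5 := h1.trans ((div_le_div_of_nonneg_right h2 hl0.le).trans h3)
  rw [show 2 / η ^ 2 = (η ^ 2)⁻¹ + (η ^ 2)⁻¹ by ring]
  exact add_le_add h4 h5

lemma statisticalDistance_bind_map_discreteGaussian_le_sqrt
    (hS : (perturbationCov T r s).PosDef) (hr : 0 < r) (hs : 0 < s) {ε : ℝ} (hε : 0 < ε)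
    (hε1 : ε < 1) (hηr : smoothingParameter (integerLattice n) ε ≤ r)
    (h : (r ^ 2 + smoothingParameter (integerLattice n) ε ^ 2) *
      (largestSingularValue (realMatrix T) ^ 2 + 1) ≤ s ^ 2) :
    statisticalDistance
      ((discreteGaussian (perturbationCov T r s)).bind fun p =>
        (discreteGaussian (r ^ 2 • (1 : Matrix (Fin n) (Fin n) ℝ))).map fun x' =>
          p + T.mulVec x')
      (discreteGaussian (s ^ 2 • (1 : Matrix (Fin m) (Fin m) ℝ))) ≤ 24 * √(n * ε) := by
  set τ := √(n * ε) with hτ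
  -- Above `1/12` the claimed bound exceeds `1`; below it, `12 τ ≤ 1` permits `exp(12 τ) - 1 ≤ 24
  -- τ`, and `n x ≤ τ` forces `x ≤ 1/8` when `n ≥ 1`.
  obtain hbig | hsmall := lt_or_ge (1 / 12) τ
  · exact (statisticalDistance_le_one _ _).trans (by linarith)
  have hτ0 : 0 ≤ τ := Real.sqrt_nonneg _
  obtain ⟨x, hx0, hx, hnx, hx8⟩ : ∃ x : ℝ, 0 ≤ x ∧
      (∀ i, Real.exp (-Real.pi / conditionalPrecision T r s i i) ≤ x) ∧ n * x ≤ τ ∧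
      x ≤ 1 / 8 := by
    -- For `n = 0` the smoothing parameter is `0`, but there are no diagonal entries to bound.
    obtain hn | hn := Nat.eq_zero_or_pos n
    · subst hn
      exact ⟨0, le_rfl, fun i => i.elim0, by simpa using hτ0, by norm_num⟩
    set η := smoothingParameter (integerLattice n) ε with hη
    have hη0 : 0 < η := smoothingParameter_pos hn hε hε1
    have hn1 : (1 : ℝ) ≤ n := by exact_mod_cast hn
    have hle : n * Real.exp (-Real.pi * η ^ 2 / 2) ≤ τ := by
      refine Real.le_sqrt_of_sq_le ?_
      rw [mul_pow, ← Real.exp_nat_mul,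
        show ((2 : ℕ) : ℝ) * (-Real.pi * η ^ 2 / 2) = -Real.pi * η ^ 2 by push_cast; ring, sq,
        mul_assoc]
      exact mul_le_mul_of_nonneg_left (nat_mul_exp_smoothingParameter_le n hε) (by linarith)
    refine ⟨Real.exp (-Real.pi * η ^ 2 / 2), (Real.exp_pos _).le, fun i => ?_, hle, ?_⟩
    · apply Real.exp_le_exp.mpr
      have h1 := conditionalPrecision_apply_self_le hr hη0 hηr h i
      have h2 := conditionalPrecision_apply_self_pos hS hr i
      rw [div_le_iff₀ h2]
      have h3 : conditionalPrecision T r s i i * η ^ 2 ≤ 2 := (le_div_iff₀ (by positivity)).mp h1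
      nlinarith [Real.pi_pos]
    · have := (Real.exp_pos (-Real.pi * η ^ 2 / 2)).le
      nlinarith
  refine (statisticalDistance_bind_map_discreteGaussian_le hS hr hs hx0 hx hx8).trans ?_
  have h1 : (1 + 12 * x) ^ n ≤ Real.exp (12 * τ) := by
    calc (1 + 12 * x) ^ n ≤ Real.exp (12 * x) ^ n := by
          gcongr
          linarith [Real.add_one_le_exp (12 * x)]
      _ = Real.exp (n * (12 * x)) := (Real.exp_nat_mul _ _).symm
      _ ≤ Real.exp (12 * τ) := Real.exp_le_exp.mpr (by linarith)
  have h2 := Real.abs_exp_sub_one_le (x := 12 * τ) (by rw [abs_of_nonneg] <;> linarith)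
  rw [abs_of_nonneg (by linarith : 0 ≤ 12 * τ)] at h2
  linarith [le_abs_self (Real.exp (12 * τ) - 1)]

end Convolution

end LatticeGaussian

theorem mainTheorem3
    (n : ℕ → ℕ) (hn : PolynomiallyBounded n)
    (ε : ℕ → ℝ) (hε : ∀ κ, 0 < ε κ ∧ ε κ < 1) (hεnegl : Negligible ε) :
    ∃ δ : ℕ → ℝ, Negligible δ ∧
      ∀ (κ m : ℕ) (T : Matrix (Fin m) (Fin (n κ)) ℤ) (r s : ℝ), 0 < r → 0 < s →
        smoothingParameter (integerLattice (n κ)) (ε κ) ≤ r →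
        (r ^ 2 + smoothingParameter (integerLattice (n κ)) (ε κ) ^ 2) *
            (largestSingularValue (realMatrix T) ^ 2 + 1) ≤ s ^ 2 →
        (perturbationCov T r s).PosDef ∧
        (discreteGaussian (jointCov T r s)).map (fun x => (convolutionMatrix T).mulVec x) =
          ((discreteGaussian (perturbationCov T r s)).bind fun p =>
            (discreteGaussian (r ^ 2 • (1 : Matrix (Fin (n κ)) (Fin (n κ)) ℝ))).map fun x' =>
              p + T.mulVec x') ∧
        statisticalDistance
          ((discreteGaussian (jointCov T r s)).map (fun x => (convolutionMatrix T).mulVec x))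
          (discreteGaussian (s ^ 2 • (1 : Matrix (Fin m) (Fin m) ℝ))) ≤ δ κ := by
  refine ⟨fun κ => 24 * √(n κ * ε κ), (hεnegl.sqrt_mul hn).const_mul 24, ?_⟩
  intro κ m T r s hr hs hηr h
  have hS : (perturbationCov T r s).PosDef := by
    -- The weaker bound `Σ_p ≥ r² I` suffices here and does not need `η > 0`.
    refine posDef_perturbationCov (l := r ^ 2) (by positivity) ?_
    have : 0 ≤ smoothingParameter (integerLattice (n κ)) (ε κ) ^ 2 *
      (largestSingularValue (realMatrix T) ^ 2 + 1) := by positivity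
    linarith
  have hmap := map_convolutionMatrix_discreteGaussian hS hr
  refine ⟨hS, hmap, ?_⟩
  rw [hmap]
  exact statisticalDistance_bind_map_discreteGaussian_le_sqrt hS hr hs (hε κ).1 (hε κ).2 hηr h
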